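/- Let $G=(V,E)$ be an infinite, simple, locally finite, connected graph with vertex degree $\deg:V\to\mathbb N$. Put $\eta(k)=\#\{v\in V\mid \deg(v)\le k\}\in\mathbb N\cup\{\infty\}$ and $$r=\sup_{k\in\mathbb N,\,k\ge1}\frac{\eta(k)}{k},\qquad r_\infty=\limsup_{k\to\infty}\frac{\eta(k)}{k},\qquad d=\min_{v\in V}\deg(v),\qquad d_\infty=\sup_{K\subseteq V\text{ finite}}\ \min_{v\in V\setminus K}\deg(v).$$ Let $\Delta$ be the graph Laplacian on the real Hilbert space $\ell^2(V)$, $$\Delta\varphi(v)=\sum_{w\sim v}(\varphi(v)-\varphi(w)),\qquad D(\Delta)=\{\varphi\in\ell^2(V)\mid\Delta\varphi\in\ell^2(V)\},$$ let $\sigma(\Delta)\subseteq\mathbb R$ be its spectrum, that is, the set of all $\mu\in\mathbb R$ for which $\Delta-\mu:D(\Delta)\to\ell^2(V)$ has no bounded everywhere defined inverse, and let $\lambda_0=\inf\sigma(\Delta)$ be the bottom of the spectrum. For $s\in[0,1]$ let $$\gamma(s)=\sqrt{1-\frac{(1-s)^4}{(1+s^2)^2}}.$$ If $d_\infty=\infty$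 and $r_\infty<1$, then $\sigma(\Delta)$ is nonempty and bounded below, and $\lambda_0>0$. If even $r<1$, then $$d\,(1-\gamma(r))\le\lambda_0.$$ -/

import Mathlib

open Filter
open scoped ENNReal

namespace RapidlyBranching

noncomputable section

variable {V : Type*}

/-- `η(x) = #{v | deg v ≤ x}`, with values in `ℕ ∪ {∞}`. -/
def eta (G : SimpleGraph V) [G.LocallyFinite] (x : ℝ) : ℕ∞ :=
  {v : V | (G.degree v : ℝ) ≤ x}.encard

/-- The quotient `η(k) / k` in `[0, ∞]`. -/
def etaRatio (G : SimpleGraph V) [G.LocallyFinite] (k : ℕ) : ℝ≥0∞ :=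
  ((eta G (k : ℝ) : ℕ∞) : ℝ≥0∞) / (k : ℝ≥0∞)

/-- `r = sup_{k ≥ 1} η(k) / k`, in `[0, ∞]`. -/
def rSup (G : SimpleGraph V) [G.LocallyFinite] : ℝ≥0∞ :=
  ⨆ (k : ℕ) (_ : 1 ≤ k), etaRatio G k

/-- `r_∞ = limsup_{k → ∞} η(k) / k`, in `[0, ∞]`. -/
def rInf (G : SimpleGraph V) [G.LocallyFinite] : ℝ≥0∞ :=
  limsup (fun k : ℕ => etaRatio G k) atTop

/-- The minimal vertex degree `d` (a minimum as soon as `V` is nonempty). -/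
def minDeg (G : SimpleGraph V) [G.LocallyFinite] : ℕ :=
  sInf (Set.range fun v : V => G.degree v)

/-- `d_∞ = sup_{K ⊆ V finite} min_{v ∈ V \ K} deg v`, in `ℕ ∪ {∞}`. -/
def dInf (G : SimpleGraph V) [G.LocallyFinite] : ℕ∞ :=
  ⨆ K : Finset V, ⨅ (v : V) (_ : v ∉ K), (G.degree v : ℕ∞)

/-- `γ(s) = √(1 - (1 - s)⁴ / (1 + s²)²)`. -/
def gammaFn (s : ℝ) : ℝ :=
  Real.sqrt (1 - (1 - s) ^ 4 / (1 + s ^ 2) ^ 2)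

/-- The formal Laplacian `(Δ φ)(v) = ∑_{w ∼ v} (φ v - φ w)` on all real functions on `V`. -/
def formalLaplacian (G : SimpleGraph V) [G.LocallyFinite] : (V → ℝ) →ₗ[ℝ] (V → ℝ) where
  toFun φ v := ∑ w ∈ G.neighborFinset v, (φ v - φ w)
  map_add' φ ψ := by
    funext v
    simp only [Pi.add_apply]
    rw [← Finset.sum_add_distrib]
    exact Finset.sum_congr rfl fun w _ => by ring
  map_smul' c φ := by
    funext v
    simp only [Pi.smul_apply, smul_eq_mul, RingHom.id_apply]
    rw [Finset.mul_sum]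
    exact Finset.sum_congr rfl fun w _ => by ring

/-- The domain `D(Δ) = {φ ∈ ℓ²(V) | Δ φ ∈ ℓ²(V)}`. -/
def laplacianDomain (G : SimpleGraph V) [G.LocallyFinite] :
    Submodule ℝ (lp (fun _ : V => ℝ) 2) where
  carrier := {φ | Memℓp (formalLaplacian G (φ : V → ℝ)) 2}
  zero_mem' := by
    simp only [Set.mem_ofPred_eq, lp.coeFn_zero, map_zero]
    exact zero_memℓp
  add_mem' {φ ψ} hφ hψ := by
    simp only [Set.mem_ofPred_eq, lp.coeFn_add, map_add] at *
    exact hφ.add hψ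
  smul_mem' c φ hφ := by
    simp only [Set.mem_ofPred_eq, lp.coeFn_smul, map_smul] at *
    exact hφ.const_smul c

/-- The Laplacian `Δ` as an unbounded operator on `ℓ²(V)` with domain `D(Δ)`. -/
def laplacian (G : SimpleGraph V) [G.LocallyFinite] :
    lp (fun _ : V => ℝ) 2 →ₗ.[ℝ] lp (fun _ : V => ℝ) 2 where
  domain := laplacianDomain G
  toFun :=
    { toFun := fun φ => ⟨formalLaplacian G ((φ : lp (fun _ : V => ℝ) 2) : V → ℝ), φ.2⟩
      map_add' := fun φ ψ => Subtype.ext (by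
        simp only [Submodule.coe_add, lp.coeFn_add, map_add]
        rfl)
      map_smul' := fun c φ => Subtype.ext (by
        simp only [Submodule.coe_smul, lp.coeFn_smul, map_smul]
        rfl) }

/-- The resolvent set of an unbounded operator `T`: those `μ` for which
`T - μ : D(T) → H` is a bijection with a bounded everywhere defined inverse `S`. -/
def resolventSet {H : Type*} [NormedAddCommGroup H] [NormedSpace ℝ H]
    (T : H →ₗ.[ℝ] H) : Set ℝ :=
  {μ | ∃ S : H →L[ℝ] H,
    (∀ y : H, ∃ h : S y ∈ T.domain, T ⟨S y, h⟩ - μ • S y = y) ∧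
    ∀ x : T.domain, S (T x - μ • (x : H)) = x}

/-- The spectrum of an unbounded operator: the complement of the resolvent set. -/
def spectrumSet {H : Type*} [NormedAddCommGroup H] [NormedSpace ℝ H]
    (T : H →ₗ.[ℝ] H) : Set ℝ :=
  (resolventSet T)ᶜ

/-- `λ₀(Δ) = inf σ(Δ)`, the bottom of the spectrum of the Laplacian. -/
def bottom (G : SimpleGraph V) [G.LocallyFinite] : ℝ :=
  sInf (spectrumSet (laplacian G))

end

end RapidlyBranching

/-! The bound is Cheeger's inequality combined with an isoperimetric estimate from vertex counting.

Isoperimetry: if `η(k) ≤ s k`, the `j`-th smallest degree in a finite set `W` is at least `j / s`,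
while a vertex of `W` has at most `m = |W| - 1` neighbours in `W`. With `S = ∑ max(m, deg v)` over
`W`, this gives `|∂W| ≥ S - (m + 1) m`, and comparing `S` with its smallest possible value yields
`(m + 1) m ≤ 2s / (1 + s²) * S`. Hence `|∂W| ≥ α deg W` with `α = (1 - s)² / (1 + s²)`
(`isoperimetric_of_card_le`). If only `r_∞ < 1`, small sets are handled by `|∂W| ≥ 1`, and some `α >
0` remains.

Cheeger: co-area and Cauchy–Schwarz bound the quadratic form below by `d (1 - √(1 - α²))` on
finitely supported functions (`IsIsoperimetric.cheeger`); for `s = r` the root is `γ(r)`.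

Spectrum: `Δ` is the adjoint of its restriction to finitely supported functions. A maximum principle
excludes the eigenvalue `-1`, so these functions are a core, the form bound extends to `D(Δ)`, and
the infimum of the Rayleigh quotients lies in the spectrum. -/

namespace RapidlyBranching

open Filter Topology

/-! ### Semibounded symmetric operators: cores, resolvent, bottom of the spectrum -/

section Abstract

variable {H : Type*} [NormedAddCommGroup H] [InnerProductSpace ℝ H]
  {E : Type*} [AddCommGroup E] [Module ℝ E]

/-- `T` is the adjoint of a symmetric operator, given on a core `E` with (not necessarily injective)
embedding `ι : E → H` by the linear map `A : E → H`. -/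
structure IsSymmAdjoint (T : H →ₗ.[ℝ] H) (ι A : E →ₗ[ℝ] H) : Prop where
  inner_eq : ∀ (f : E) (u : T.domain), inner ℝ (A f) (u : H) = inner ℝ (ι f) (T u)
  exists_of_inner_eq : ∀ u y : H, (∀ f : E, inner ℝ (A f) u = inner ℝ (ι f) y) →
    ∃ h : u ∈ T.domain, T ⟨u, h⟩ = y
  symm : ∀ f g : E, inner ℝ (A f) (ι g) = inner ℝ (ι f) (A g)

/-- `u` is approximated in graph norm by elements of the core. -/
def IsCoreLimit (T : H →ₗ.[ℝ] H) (ι A : E →ₗ[ℝ] H) (u : T.domain) : Prop :=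
  ∃ f : ℕ → E, Tendsto (fun n => ι (f n)) atTop (𝓝 (u : H)) ∧
    Tendsto (fun n => A (f n)) atTop (𝓝 (T u))

variable {T : H →ₗ.[ℝ] H} {ι A : E →ₗ[ℝ] H} {c : ℝ}

theorem mul_norm_le_norm_sub {x y : H} {c μ : ℝ} (h : c * ‖x‖ ^ 2 ≤ inner ℝ y x) :
    (c - μ) * ‖x‖ ≤ ‖y - μ • x‖ := by
  rcases (norm_nonneg x).eq_or_lt with h0 | h0
  · rw [← h0]; simp
  · have h1 : inner ℝ (y - μ • x) x = inner ℝ y x - μ * ‖x‖ ^ 2 := by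
      rw [inner_sub_left, real_inner_smul_left, real_inner_self_eq_norm_sq]
    have h2 := real_inner_le_norm (y - μ • x) x
    refine le_of_mul_le_mul_right ?_ h0
    nlinarith

namespace IsSymmAdjoint

/-- A vector orthogonal to the range of `A - μ ι` lies in the kernel of `T - μ`, so this range is
dense. The form bound makes approximate solutions Cauchy, and the adjoint relation identifies their
limit. -/
theorem exists_coreLimit_sub_eq [CompleteSpace H] (hT : IsSymmAdjoint T ι A)
    (hA : ∀ f, c * ‖ι f‖ ^ 2 ≤ inner ℝ (A f) (ι f)) {μ : ℝ} (hμ : μ < c)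
    (hker : ∀ u : T.domain, T u = μ • (u : H) → (u : H) = 0) (y : H) :
    ∃ u : T.domain, IsCoreLimit T ι A u ∧ T u - μ • (u : H) = y := by
  have hdense : (LinearMap.range (A - μ • ι)).topologicalClosure = ⊤ := by
    rw [Submodule.topologicalClosure_eq_top_iff, Submodule.eq_bot_iff]
    intro u hu
    rw [Submodule.mem_orthogonal] at hu
    obtain ⟨h, hTu⟩ := hT.exists_of_inner_eq u (μ • u) fun f => by
      have := hu _ (LinearMap.mem_range_self _ f)
      rw [LinearMap.sub_apply, LinearMap.smul_apply, inner_sub_left, real_inner_smul_left] at this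
      rw [real_inner_smul_right]
      linarith
    exact hker ⟨u, h⟩ hTu
  have hy : y ∈ closure (LinearMap.range (A - μ • ι) : Set H) := by
    rw [← Submodule.topologicalClosure_coe, hdense]; trivial
  obtain ⟨z, hz, hzy⟩ := mem_closure_iff_seq_limit.1 hy
  choose f hf using hz
  have hfy : Tendsto (fun n => A (f n) - μ • ι (f n)) atTop (𝓝 y) := by
    refine hzy.congr fun n => ?_
    rw [← hf n]; rfl
  have hcauchy : CauchySeq fun n => ι (f n) := by
    have h1 := hfy.cauchySeq
    rw [Metric.cauchySeq_iff] at h1 ⊢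
    intro ε hε
    obtain ⟨N, hN⟩ := h1 ((c - μ) * ε) (mul_pos (sub_pos.2 hμ) hε)
    refine ⟨N, fun m hm n hn => ?_⟩
    have h2 := hN m hm n hn
    have h3 := mul_norm_le_norm_sub (μ := μ) (hA (f m - f n))
    rw [dist_eq_norm] at h2 ⊢
    have h4 : A (f m) - μ • ι (f m) - (A (f n) - μ • ι (f n))
        = A (f m - f n) - μ • ι (f m - f n) := by
      rw [map_sub, map_sub, smul_sub]; abel
    rw [h4] at h2
    rw [← map_sub]
    exact lt_of_mul_lt_mul_left (h3.trans_lt h2) (sub_pos.2 hμ).le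
  obtain ⟨u, hu⟩ := cauchySeq_tendsto_of_complete hcauchy
  have hAu : Tendsto (fun n => A (f n)) atTop (𝓝 (y + μ • u)) := by
    refine (hfy.add (hu.const_smul μ)).congr fun n => ?_
    simp
  obtain ⟨h, hTu⟩ := hT.exists_of_inner_eq u (y + μ • u) fun g =>
    tendsto_nhds_unique ((tendsto_const_nhds (x := A g)).inner hu)
      (((tendsto_const_nhds (x := ι g)).inner hAu).congr fun n => (hT.symm g (f n)).symm)
  exact ⟨⟨u, h⟩, ⟨f, hu, by rwa [hTu]⟩, by simp [hTu]⟩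

/-- Essential self-adjointness: a core limit solving the same equation as `u` differs from `u` by an
element of the kernel of `T - μ`. -/
theorem isCoreLimit [CompleteSpace H] (hT : IsSymmAdjoint T ι A)
    (hA : ∀ f, c * ‖ι f‖ ^ 2 ≤ inner ℝ (A f) (ι f)) {μ : ℝ} (hμ : μ < c)
    (hker : ∀ u : T.domain, T u = μ • (u : H) → (u : H) = 0) (u : T.domain) :
    IsCoreLimit T ι A u := by
  obtain ⟨w, hw, hwu⟩ := hT.exists_coreLimit_sub_eq hA hμ hker (T u - μ • (u : H))
  have h := hker (w - u) (by
    rw [LinearPMap.map_sub, Submodule.coe_sub, smul_sub]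
    rw [sub_eq_sub_iff_sub_eq_sub] at hwu
    exact hwu)
  rw [Submodule.coe_sub, sub_eq_zero] at h
  rwa [← Subtype.ext h]

theorem inner_symm (hT : IsSymmAdjoint T ι A) {u : T.domain} (hu : IsCoreLimit T ι A u)
    (w : T.domain) : inner ℝ (T u) (w : H) = inner ℝ (u : H) (T w) := by
  obtain ⟨f, h1, h2⟩ := hu
  exact tendsto_nhds_unique (h2.inner tendsto_const_nhds)
    ((h1.inner tendsto_const_nhds).congr fun n => (hT.inner_eq (f n) w).symm)

theorem mem_domain (hT : IsSymmAdjoint T ι A) (f : E) :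
    ∃ h : ι f ∈ T.domain, T ⟨ι f, h⟩ = A f :=
  hT.exists_of_inner_eq _ _ fun g => hT.symm g f

end IsSymmAdjoint

theorem IsCoreLimit.mul_norm_sq_le (hA : ∀ f, c * ‖ι f‖ ^ 2 ≤ inner ℝ (A f) (ι f))
    {u : T.domain} (hu : IsCoreLimit T ι A u) : c * ‖(u : H)‖ ^ 2 ≤ inner ℝ (T u) (u : H) := by
  obtain ⟨f, h1, h2⟩ := hu
  exact le_of_tendsto_of_tendsto' ((h1.norm.pow 2).const_mul c) (h2.inner h1) fun n => hA (f n)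

namespace IsSymmAdjoint

theorem mem_resolventSet_of_lt [CompleteSpace H] (hT : IsSymmAdjoint T ι A)
    (hA : ∀ f, c * ‖ι f‖ ^ 2 ≤ inner ℝ (A f) (ι f)) (hcore : ∀ u, IsCoreLimit T ι A u)
    {μ : ℝ} (hμ : μ < c) : μ ∈ resolventSet T := by
  have hbound (u : T.domain) : (c - μ) * ‖(u : H)‖ ≤ ‖T u - μ • (u : H)‖ :=
    mul_norm_le_norm_sub ((hcore u).mul_norm_sq_le hA)
  have hpos := sub_pos.2 hμ
  have hker (u : T.domain) (hu : T u - μ • (u : H) = 0) : u = 0 := by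
    have := hbound u
    rw [hu, norm_zero] at this
    exact Subtype.ext (norm_le_zero_iff.1 (nonpos_of_mul_nonpos_right this hpos))
  let L : T.domain →ₗ[ℝ] H := T.toFun - μ • T.domain.subtype
  have hL (u : T.domain) : L u = T u - μ • (u : H) := rfl
  have hinj : Function.Injective L := (injective_iff_map_eq_zero L).2 fun u hu => hker u hu
  have hsurj : Function.Surjective L := fun y => by
    obtain ⟨u, -, hu⟩ := hT.exists_coreLimit_sub_eq hA hμ
      (fun u hu => by rw [hker u (sub_eq_zero.2 hu)]; rfl) y
    exact ⟨u, hu⟩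
  let e := LinearEquiv.ofBijective L ⟨hinj, hsurj⟩
  have he (u : T.domain) : e u = T u - μ • (u : H) := rfl
  let S : H →L[ℝ] H := (T.domain.subtype ∘ₗ e.symm.toLinearMap).mkContinuous (c - μ)⁻¹ fun y => by
    have := hbound (e.symm y)
    rw [← he, LinearEquiv.apply_symm_apply] at this
    rw [inv_mul_eq_div, le_div_iff₀' hpos]
    exact this
  have hS (y : H) : S y = (e.symm y : H) := rfl
  refine ⟨S, fun y => ⟨(e.symm y).2, ?_⟩, fun u => ?_⟩
  · exact e.apply_symm_apply y
  · rw [hS, ← he, e.symm_apply_apply]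

/-- If `T - c` had a bounded inverse `S`, its nonnegative form, tested on `x - t S x` with `x`
almost minimizing, would become negative: the cross term is exactly `-2t`, the other two are small.
-/
theorem mem_spectrumSet (hT : IsSymmAdjoint T ι A)
    (hA : ∀ f, c * ‖ι f‖ ^ 2 ≤ inner ℝ (A f) (ι f)) (hcore : ∀ u, IsCoreLimit T ι A u)
    (hsharp : ∀ ε > 0, ∃ f, ‖ι f‖ = 1 ∧ inner ℝ (A f) (ι f) < c + ε) : c ∈ spectrumSet T := by
  rintro ⟨S, hS, -⟩
  obtain ⟨f, hf, hlt⟩ := hsharp (‖S‖ + 1)⁻¹ (by positivity)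
  obtain ⟨hx, hTx⟩ := hT.mem_domain f
  obtain ⟨hw, hTw⟩ := hS (ι f)
  set x : T.domain := ⟨ι f, hx⟩
  set w : T.domain := ⟨S (ι f), hw⟩
  have hTw' : T w = ι f + c • S (ι f) := sub_eq_iff_eq_add.1 hTw
  have hxw : inner ℝ (T x) (w : H) - c * inner ℝ (ι f) (S (ι f)) = 1 := by
    rw [hT.inner_symm (hcore x), hTw', inner_add_right, real_inner_smul_right]
    simp only [x]
    rw [real_inner_self_eq_norm_sq, hf]; ring
  have hww : inner ℝ (T w) (w : H) - c * ‖(w : H)‖ ^ 2 ≤ ‖S‖ := by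
    rw [hTw', inner_add_left, real_inner_smul_left]
    simp only [w]
    rw [real_inner_self_eq_norm_sq, add_sub_cancel_right]
    calc _ ≤ ‖ι f‖ * ‖S (ι f)‖ := real_inner_le_norm _ _
      _ ≤ 1 * (‖S‖ * 1) := by
        rw [hf]; gcongr; simpa [hf] using S.le_opNorm (ι f)
      _ = ‖S‖ := by ring
  set q := inner ℝ (A f) (ι f) - c
  have hq : q < (‖S‖ + 1)⁻¹ := by simp only [q]; linarith
  have key (t : ℝ) : 0 ≤ q - 2 * t + t ^ 2 * ‖S‖ := by
    have h := (hcore (x - t • w)).mul_norm_sq_le hA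
    rw [← real_inner_self_eq_norm_sq, LinearPMap.map_sub, LinearPMap.map_smul, Submodule.coe_sub,
      Submodule.coe_smul] at h
    simp only [inner_sub_left, inner_sub_right, real_inner_smul_left, real_inner_smul_right] at h
    have h1 : inner ℝ (T w) (x : H) = inner ℝ (T x) (w : H) := by
      rw [hT.inner_symm (hcore w), real_inner_comm]
    have h2 : inner ℝ (w : H) (x : H) = inner ℝ (ι f) (S (ι f)) := real_inner_comm _ _
    have h3 : inner ℝ (x : H) (w : H) = inner ℝ (ι f) (S (ι f)) := rfl
    have h4 : inner ℝ (T x) (x : H) = q + c := by simp [q, hTx, x]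
    have h5 : ‖(x : H)‖ = 1 := hf
    rw [real_inner_self_eq_norm_sq, real_inner_self_eq_norm_sq, h1, h2, h3, h4, h5] at h
    linear_combination h + mul_le_mul_of_nonneg_left hww (sq_nonneg t) - 2 * t * hxw
  have hpos : 0 < ‖S‖ + 1 := by positivity
  -- For this `t` one has `q < t` and `t ‖S‖ < 1`, so the expression in `key` is negative.
  have h := key (‖S‖ + 1)⁻¹
  have hinv : (‖S‖ + 1)⁻¹ * (‖S‖ + 1) = 1 := inv_mul_cancel₀ hpos.ne'
  have : 0 < (‖S‖ + 1)⁻¹ := inv_pos.2 hpos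
  nlinarith

end IsSymmAdjoint

end Abstract

end RapidlyBranching

namespace RapidlyBranching

noncomputable section

variable {V : Type*}

/-! ### The Laplacian on finitely supported functions and its adjoint -/

section Core

open Classical in
/-- The indicator of a vertex, as an element of `ℓ²(V)`. -/
def delta (v : V) : lp (fun _ : V => ℝ) 2 := lp.single 2 v 1

theorem delta_apply (v w : V) [Decidable (w = v)] :
    (delta v : V → ℝ) w = if w = v then 1 else 0 := by
  classical
  rw [delta, lp.single_apply, Pi.single_apply]
  congr

theorem inner_delta (v : V) (u : lp (fun _ : V => ℝ) 2) : inner ℝ (delta v) u = u v := by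
  classical
  rw [delta, lp.inner_single_left]
  simp

/-- Finitely supported functions as elements of `ℓ²(V)`. -/
def coreEmb (V : Type*) : (V →₀ ℝ) →ₗ[ℝ] lp (fun _ : V => ℝ) 2 :=
  Finsupp.linearCombination ℝ delta

/-- The Laplacian on finitely supported functions. -/
def coreLaplacian (G : SimpleGraph V) [G.LocallyFinite] :
    (V →₀ ℝ) →ₗ[ℝ] lp (fun _ : V => ℝ) 2 :=
  Finsupp.linearCombination ℝ fun v => ∑ w ∈ G.neighborFinset v, (delta v - delta w)

variable (G : SimpleGraph V) [G.LocallyFinite]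

theorem formalLaplacian_apply (φ : V → ℝ) (v : V) :
    formalLaplacian G φ v = ∑ w ∈ G.neighborFinset v, (φ v - φ w) := rfl

theorem inner_coreEmb (f : V →₀ ℝ) (u : lp (fun _ : V => ℝ) 2) :
    inner ℝ (coreEmb V f) u = f.sum fun v a => a * u v := by
  rw [coreEmb, Finsupp.linearCombination_apply, Finsupp.sum, Finsupp.sum, sum_inner]
  exact Finset.sum_congr rfl fun v _ => by rw [real_inner_smul_left, inner_delta]

theorem inner_coreLaplacian (f : V →₀ ℝ) (u : lp (fun _ : V => ℝ) 2) :
    inner ℝ (coreLaplacian G f) u = f.sum fun v a => a * formalLaplacian G u v := by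
  rw [coreLaplacian, Finsupp.linearCombination_apply, Finsupp.sum, Finsupp.sum, sum_inner]
  refine Finset.sum_congr rfl fun v _ => ?_
  rw [real_inner_smul_left, sum_inner, formalLaplacian_apply]
  simp only [inner_sub_left, inner_delta]

theorem coreEmb_apply (f : V →₀ ℝ) : (coreEmb V f : V → ℝ) = f := by
  classical
  funext w
  rw [← inner_delta w, real_inner_comm, inner_coreEmb]
  simp only [delta_apply]
  simpa [Finsupp.sum] using Eq.symm

theorem coreLaplacian_single (v : V) :
    (coreLaplacian G (Finsupp.single v 1) : V → ℝ) = formalLaplacian G (Finsupp.single v 1) := by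
  classical
  funext w
  rw [← inner_delta w, real_inner_comm, inner_coreLaplacian,
    Finsupp.sum_single_index (by simp), one_mul, formalLaplacian_apply, formalLaplacian_apply]
  simp only [delta_apply, Finsupp.single_apply, Finset.sum_sub_distrib, Finset.sum_const,
    Finset.sum_ite_eq', Finset.sum_ite_eq, SimpleGraph.mem_neighborFinset, G.adj_comm v w]
  congr 1
  by_cases h : v = w
  · subst h; simp
  · simp [h]

theorem coreLaplacian_apply (f : V →₀ ℝ) :
    (coreLaplacian G f : V → ℝ) = formalLaplacian G f := by
  induction f using Finsupp.induction_linear with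
  | zero => rw [map_zero, Finsupp.coe_zero, map_zero]; rfl
  | add f g hf hg => rw [map_add, lp.coeFn_add, hf, hg, Finsupp.coe_add, map_add]
  | single v a =>
    have : Finsupp.single v a = a • Finsupp.single v (1 : ℝ) := by simp
    rw [this, map_smul, lp.coeFn_smul, coreLaplacian_single, Finsupp.coe_smul, map_smul]

theorem laplacian_apply (u : (laplacian G).domain) :
    (laplacian G u : V → ℝ) = formalLaplacian G (u : lp (fun _ : V => ℝ) 2) := rfl

/-- Testing against vertex indicators recovers the formal Laplacian pointwise, and `D(Δ)` is the
maximal domain. -/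
theorem isSymmAdjoint_laplacian : IsSymmAdjoint (laplacian G) (coreEmb V) (coreLaplacian G) := by
  have hadj : ∀ u y : lp (fun _ : V => ℝ) 2,
      (∀ f, inner ℝ (coreLaplacian G f) u = inner ℝ (coreEmb V f) y) →
      formalLaplacian G u = y := fun u y h => by
    funext v
    have := h (Finsupp.single v 1)
    rw [inner_coreLaplacian, inner_coreEmb] at this
    simpa using this
  refine ⟨fun f u => ?_, fun u y h => ?_, fun f g => ?_⟩
  · rw [inner_coreLaplacian, inner_coreEmb, ← laplacian_apply]
  · have hm : u ∈ (laplacian G).domain := by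
      change Memℓp (formalLaplacian G (u : V → ℝ)) 2
      rw [hadj u y h]
      exact y.2
    exact ⟨hm, Subtype.ext (hadj u y h)⟩
  · rw [inner_coreLaplacian, inner_coreEmb, coreEmb_apply, coreLaplacian_apply]

/-- A square summable function exceeds any positive level at finitely many vertices only. -/
theorem finite_setOf_le (u : lp (fun _ : V => ℝ) 2) {ε : ℝ} (hε : 0 < ε) :
    {v | ε ≤ u v}.Finite := by
  have h := (lp.memℓp u).summable (by norm_num)
  have h1 := h.tendsto_cofinite_zero.eventually (gt_mem_nhds (pow_pos hε 2))
  refine Set.Finite.subset h1 fun v hv => ?_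
  have hv : ε ≤ u v := hv
  simp only [Set.mem_compl_iff, Set.mem_ofPred_eq, not_lt]
  norm_num
  gcongr

/-- Maximum principle: a positive value forces a positive maximum, attained because superlevel sets
are finite. There `Δu ≥ 0`, whereas `-u < 0`. -/
theorem apply_nonpos_of_formalLaplacian_eq_neg (u : lp (fun _ : V => ℝ) 2)
    (hu : formalLaplacian G u = -(u : V → ℝ)) (v : V) : u v ≤ 0 := by
  by_contra! hv
  obtain ⟨w, hw, hmax⟩ :=
    Set.exists_max_image _ (fun w => u w) (finite_setOf_le u hv) ⟨v, le_refl (u v)⟩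
  have hw : u v ≤ u w := hw
  have h1 : 0 ≤ formalLaplacian G u w := Finset.sum_nonneg fun x _ => by
    rcases le_total (u v) (u x) with h | h
    · exact sub_nonneg.2 (hmax x h)
    · linarith
  rw [hu, Pi.neg_apply] at h1
  linarith

theorem eq_zero_of_laplacian_eq_neg (u : (laplacian G).domain)
    (hu : laplacian G u = (-1 : ℝ) • (u : lp (fun _ : V => ℝ) 2)) :
    (u : lp (fun _ : V => ℝ) 2) = 0 := by
  have h : formalLaplacian G (u : lp (fun _ : V => ℝ) 2) =
      -((u : lp (fun _ : V => ℝ) 2) : V → ℝ) := by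
    rw [← laplacian_apply, hu, neg_one_smul, lp.coeFn_neg]
  ext v
  refine le_antisymm (apply_nonpos_of_formalLaplacian_eq_neg G _ h v) ?_
  have h2 := apply_nonpos_of_formalLaplacian_eq_neg G (-u : lp (fun _ : V => ℝ) 2)
    (by rw [lp.coeFn_neg, map_neg, h]) v
  rw [lp.coeFn_neg, Pi.neg_apply] at h2
  simpa using h2

/-- If the quadratic form of the Laplacian is bounded below by `b ≥ 0` on finitely supported
functions, then the spectrum is nonempty and contained in `[b, ∞)`. -/
theorem spectrumSet_laplacian_nonempty_and_le [Nonempty V] {b : ℝ} (hb : 0 ≤ b)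
    (hform : ∀ f : V →₀ ℝ,
      b * ‖coreEmb V f‖ ^ 2 ≤ inner ℝ (coreLaplacian G f) (coreEmb V f)) :
    (spectrumSet (laplacian G)).Nonempty ∧ ∀ μ ∈ spectrumSet (laplacian G), b ≤ μ := by
  have hT := isSymmAdjoint_laplacian G
  have hcore : ∀ u, IsCoreLimit (laplacian G) (coreEmb V) (coreLaplacian G) u :=
    hT.isCoreLimit hform (μ := -1) (by linarith) (eq_zero_of_laplacian_eq_neg G)
  refine ⟨?_, fun μ hμ => not_lt.1 fun h => hμ (hT.mem_resolventSet_of_lt hform hcore h)⟩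
  -- The Rayleigh quotients; their infimum is the best form bound, hence a point of the spectrum.
  set R : Set ℝ := {x | ∃ f, ‖coreEmb V f‖ = 1 ∧ inner ℝ (coreLaplacian G f) (coreEmb V f) = x}
    with hR
  have hbdd : BddBelow R := ⟨b, by
    rintro x ⟨f, hf, rfl⟩
    simpa [hf] using hform f⟩
  have hne : R.Nonempty := by
    classical
    obtain ⟨v⟩ := ‹Nonempty V›
    refine ⟨_, Finsupp.single v 1, ?_, rfl⟩
    simp only [coreEmb, Finsupp.linearCombination_single, one_smul, delta]
    rw [lp.norm_single (by norm_num)]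
    simp
  have hform' (f : V →₀ ℝ) :
      sInf R * ‖coreEmb V f‖ ^ 2 ≤ inner ℝ (coreLaplacian G f) (coreEmb V f) := by
    rcases eq_or_ne (coreEmb V f) 0 with h0 | h0
    · simp [h0]
    have hn : 0 < ‖coreEmb V f‖ := norm_pos_iff.2 h0
    have h := csInf_le hbdd (a := inner ℝ (coreLaplacian G (‖coreEmb V f‖⁻¹ • f))
      (coreEmb V (‖coreEmb V f‖⁻¹ • f))) ⟨_, by
        rw [map_smul, norm_smul, norm_inv, norm_norm, inv_mul_cancel₀ hn.ne'], rfl⟩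
    rw [map_smul, map_smul, real_inner_smul_left, real_inner_smul_right, ← mul_assoc,
      ← mul_inv, ← sq, inv_mul_eq_div, le_div_iff₀ (by positivity)] at h
    exact h
  refine ⟨sInf R, hT.mem_spectrumSet hform' hcore fun ε hε => ?_⟩
  obtain ⟨_, ⟨f, hf, rfl⟩, hlt⟩ := exists_lt_of_csInf_lt hne (lt_add_of_pos_right (sInf R) hε)
  exact ⟨f, hf, hlt⟩

end Core

end

end RapidlyBranching

namespace RapidlyBranching

noncomputable section

variable {V : Type*}

/-! ### Isoperimetric constants and Cheeger's inequality -/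

section Cheeger

variable (G : SimpleGraph V) [G.LocallyFinite]

open Classical in
/-- The number of edges leaving a finite set of vertices. -/
def boundaryCard (W : Finset V) : ℕ := ∑ v ∈ W, (G.neighborFinset v \ W).card

/-- `α` is a lower bound for the isoperimetric quotient `|∂W| / deg W` over finite sets `W`. -/
def IsIsoperimetric (α : ℝ) : Prop :=
  ∀ W : Finset V, α * ∑ v ∈ W, (G.degree v : ℝ) ≤ boundaryCard G W

variable {G} {α : ℝ}

/-- The co-area inequality. -/
theorem IsIsoperimetric.coarea (hα : IsIsoperimetric G α) (W : Finset V) (g : V → ℝ)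
    (hpos : ∀ v ∈ W, 0 < g v) (hzero : ∀ v ∉ W, g v = 0) :
    α * ∑ v ∈ W, G.degree v * g v ≤ ∑ v ∈ W, ∑ w ∈ G.neighborFinset v, max (g v - g w) 0 := by
  classical
  induction W using Finset.strongInduction generalizing g with
  | H W ih =>
  rcases W.eq_empty_or_nonempty with rfl | hW
  · simp
  -- Peel off the lowest layer: subtracting the minimum `t` of `g` on `W` shrinks the support, and
  -- costs `t` per boundary edge on one side and `t deg W` on the other.
  obtain ⟨v₀, hv₀, hmin⟩ := W.exists_min_image g hW
  set t := g v₀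
  have ht : 0 < t := hpos v₀ hv₀
  set W' := W.filter fun v => t < g v with hW'
  have hsub : W' ⊂ W := Finset.filter_ssubset.2 ⟨v₀, hv₀, lt_irrefl t⟩
  set g' : V → ℝ := fun v => if v ∈ W then g v - t else 0 with hg'
  have hg'W (v : V) (hv : v ∈ W) : g' v = g v - t := if_pos hv
  have hg'n (v : V) (hv : v ∉ W) : g' v = 0 := if_neg hv
  have hnn (v : V) : 0 ≤ g' v := by
    by_cases hv : v ∈ W
    · rw [hg'W v hv]; exact sub_nonneg.2 (hmin v hv)
    · rw [hg'n v hv]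
  have hz (v : V) (hv : v ∉ W') : g' v = 0 := by
    by_cases hvW : v ∈ W
    · have : g v ≤ t := by
        by_contra! h
        exact hv (Finset.mem_filter.2 ⟨hvW, h⟩)
      exact le_antisymm (by rw [hg'W v hvW]; linarith) (hnn v)
    · exact hg'n v hvW
  have h := ih W' hsub g' (fun v hv => by
    rw [hg'W v (hsub.1 hv)]; exact sub_pos.2 (Finset.mem_filter.1 hv).2) hz
  rw [Finset.sum_subset hsub.1 fun v _ hv => by rw [hz v hv, mul_zero],
    Finset.sum_subset hsub.1 fun v _ hv => by
      refine Finset.sum_eq_zero fun w _ => max_eq_right ?_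
      rw [hz v hv]; linarith [hnn w]] at h
  have h1 : ∑ v ∈ W, G.degree v * g v
      = ∑ v ∈ W, G.degree v * g' v + t * ∑ v ∈ W, (G.degree v : ℝ) := by
    rw [Finset.mul_sum, ← Finset.sum_add_distrib]
    exact Finset.sum_congr rfl fun v hv => by rw [hg'W v hv]; ring
  have h2 : ∑ v ∈ W, ∑ w ∈ G.neighborFinset v, max (g v - g w) 0
      = ∑ v ∈ W, ∑ w ∈ G.neighborFinset v, max (g' v - g' w) 0 + t * boundaryCard G W := by
    rw [boundaryCard, Nat.cast_sum, Finset.mul_sum, ← Finset.sum_add_distrib]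
    refine Finset.sum_congr rfl fun v hv => ?_
    have h3 : t * ((G.neighborFinset v \ W).card : ℝ)
        = ∑ w ∈ G.neighborFinset v, if w ∉ W then t else 0 := by
      rw [← Finset.sum_filter, Finset.sum_const, nsmul_eq_mul, mul_comm, ← Finset.sdiff_eq_filter]
    rw [h3, ← Finset.sum_add_distrib]
    refine Finset.sum_congr rfl fun w _ => ?_
    by_cases hw : w ∈ W
    · rw [hg'W v hv, hg'W w hw, if_neg (not_not.2 hw)]
      simp
    · have := hmin v hv
      rw [hg'W v hv, hg'n w hw, hzero w hw, if_pos hw, max_eq_left, max_eq_left] <;> linarith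
  rw [h1, h2, mul_add]
  have h3 := mul_le_mul_of_nonneg_left (hα W) ht.le
  linarith

/-- Completing the square gives `(2D - Q)² ≤ 4D²(1 - α²)`. The factor 2 arises because `Q` counts
each edge in both orientations. -/
theorem le_of_sq_le_mul_sub {α D Q : ℝ} (hD : 0 ≤ D) (h : (2 * α * D) ^ 2 ≤ Q * (4 * D - Q)) :
    2 * (D * (1 - √(1 - α ^ 2))) ≤ Q := by
  have hs : 1 - α ^ 2 ≤ √(1 - α ^ 2) ^ 2 := by
    rcases le_total 0 (1 - α ^ 2) with h | h
    · exact (Real.sq_sqrt h).ge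
    · exact h.trans (sq_nonneg _)
  have h1 : (2 * D - Q) ^ 2 ≤ (2 * D * √(1 - α ^ 2)) ^ 2 := by
    nlinarith [mul_le_mul_of_nonneg_left hs (sq_nonneg D)]
  have := abs_le_of_sq_le_sq' h1 (by positivity)
  linarith [this.2]

open Classical in
/-- The oriented edges between vertices of a finite set. -/
def edgePairs (G : SimpleGraph V) (K : Finset V) : Finset (V × V) :=
  (K ×ˢ K).filter fun p => G.Adj p.1 p.2

theorem sum_edgePairs_swap (G : SimpleGraph V) (K : Finset V) (F : V → V → ℝ) :
    ∑ p ∈ edgePairs G K, F p.2 p.1 = ∑ p ∈ edgePairs G K, F p.1 p.2 :=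
  Finset.sum_nbij' Prod.swap Prod.swap
    (fun p hp => by simp_all [edgePairs, G.adj_comm])
    (fun p hp => by simp_all [edgePairs, G.adj_comm])
    (fun _ _ => rfl) (fun _ _ => rfl) (fun _ _ => rfl)

theorem sum_edgePairs {K W : Finset V} (hWK : W ⊆ K) (hK : ∀ v ∈ W, G.neighborFinset v ⊆ K)
    {F : V → V → ℝ} (hF : ∀ v ∉ W, ∀ w, F v w = 0) :
    ∑ p ∈ edgePairs G K, F p.1 p.2 = ∑ v ∈ W, ∑ w ∈ G.neighborFinset v, F v w := by
  classical
  rw [edgePairs, Finset.sum_filter, Finset.sum_product,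
    ← Finset.sum_subset hWK fun v _ hv => Finset.sum_eq_zero fun w _ => by
      simp only [hF v hv, ite_self]]
  refine Finset.sum_congr rfl fun v hv => ?_
  rw [← Finset.sum_filter]
  refine Finset.sum_congr (Finset.ext fun w => ?_) fun _ _ => rfl
  have := @hK v hv w
  simp only [SimpleGraph.mem_neighborFinset] at this
  simp only [Finset.mem_filter, SimpleGraph.mem_neighborFinset]
  tauto

/-- Cheeger's inequality for the Laplacian. -/
theorem IsIsoperimetric.cheeger (hα : IsIsoperimetric G α) (hα0 : 0 ≤ α) (f : V →₀ ℝ) :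
    (f.sum fun v a => G.degree v * a ^ 2) * (1 - √(1 - α ^ 2))
      ≤ f.sum fun v a => a * formalLaplacian G f v := by
  classical
  set W := f.support with hW
  -- Adding the neighbours captures every edge meeting the support in an index set invariant under
  -- reversal.
  set K := W ∪ W.biUnion fun v => G.neighborFinset v with hKdef
  have hWK : W ⊆ K := Finset.subset_union_left
  have hK (v) (hv : v ∈ W) : G.neighborFinset v ⊆ K :=
    (Finset.subset_biUnion_of_mem (fun v => G.neighborFinset v) hv).trans
      Finset.subset_union_right
  have hf0 (v) (hv : v ∉ W) : f v = 0 := Finsupp.notMem_support_iff.1 hv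
  set P := edgePairs G K with hP
  set D := ∑ p ∈ P, f p.1 ^ 2 with hD
  have hD' : D = f.sum fun v a => G.degree v * a ^ 2 := by
    rw [hD, sum_edgePairs hWK hK (F := fun v _ => f v ^ 2) fun v hv w => by
      rw [hf0 v hv]; norm_num]
    refine Finset.sum_congr rfl fun v _ => ?_
    rw [Finset.sum_const, nsmul_eq_mul, SimpleGraph.card_neighborFinset_eq_degree]
  have hDswap : ∑ p ∈ P, f p.2 ^ 2 = D := sum_edgePairs_swap G K fun v _ => f v ^ 2
  have hE : (f.sum fun v a => a * formalLaplacian G f v) = ∑ p ∈ P, f p.1 * (f p.1 - f p.2) := by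
    rw [sum_edgePairs hWK hK (F := fun v w => f v * (f v - f w)) fun v hv w => by
      rw [hf0 v hv, zero_mul]]
    refine Finset.sum_congr rfl fun v _ => ?_
    change f v * formalLaplacian G f v = _
    rw [formalLaplacian_apply, Finset.mul_sum]
  have hE2 : 2 * ∑ p ∈ P, f p.1 * (f p.1 - f p.2) = ∑ p ∈ P, (f p.1 - f p.2) ^ 2 := by
    have h := sum_edgePairs_swap G K fun v w => f v * (f v - f w)
    rw [two_mul]
    nth_rewrite 1 [← h]
    rw [← Finset.sum_add_distrib]
    exact Finset.sum_congr rfl fun p _ => by ring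
  -- Passing to `|f|` does not raise the energy, and `f(v)² - f(w)²` factors into `|f v| - |f w|`
  -- and `|f v| + |f w|`, ready for Cauchy–Schwarz.
  set Q := ∑ p ∈ P, (|f p.1| - |f p.2|) ^ 2 with hQ
  have hQE : Q ≤ ∑ p ∈ P, (f p.1 - f p.2) ^ 2 := Finset.sum_le_sum fun p _ =>
    sq_le_sq.2 (abs_abs_sub_abs_le _ _)
  have hQD : ∑ p ∈ P, (|f p.1| + |f p.2|) ^ 2 = 4 * D - Q := by
    have h : 4 * D = 2 * D + 2 * ∑ p ∈ P, f p.2 ^ 2 := by rw [hDswap]; ring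
    rw [h, hD, hQ, Finset.mul_sum, Finset.mul_sum, ← Finset.sum_add_distrib,
      ← Finset.sum_sub_distrib]
    refine Finset.sum_congr rfl fun p _ => ?_
    rw [← sq_abs (f p.1), ← sq_abs (f p.2)]
    ring
  have hcoarea : 2 * α * D ≤ ∑ p ∈ P, |f p.1 ^ 2 - f p.2 ^ 2| := by
    have h1 := hα.coarea W (fun v => f v ^ 2)
      (fun v hv => by have := Finsupp.mem_support_iff.1 hv; positivity)
      (fun v hv => by rw [hf0 v hv]; norm_num)
    rw [← sum_edgePairs hWK hK (F := fun v w => max (f v ^ 2 - f w ^ 2) 0) fun v hv w => by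
      rw [hf0 v hv]; exact max_eq_right (by nlinarith [sq_nonneg (f w)])] at h1
    have h2 := sum_edgePairs_swap G K fun v w => max (f v ^ 2 - f w ^ 2) 0
    have h3 : ∑ p ∈ P, |f p.1 ^ 2 - f p.2 ^ 2|
        = ∑ p ∈ P, max (f p.1 ^ 2 - f p.2 ^ 2) 0 + ∑ p ∈ P, max (f p.2 ^ 2 - f p.1 ^ 2) 0 := by
      rw [← Finset.sum_add_distrib]
      refine Finset.sum_congr rfl fun p _ => ?_
      rcases le_total (f p.1 ^ 2) (f p.2 ^ 2) with h | h
      · rw [abs_of_nonpos (by linarith), max_eq_right (by linarith), max_eq_left (by linarith)]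
        ring
      · rw [abs_of_nonneg (by linarith), max_eq_left (by linarith), max_eq_right (by linarith)]
        ring
    rw [h3, h2, hD']
    change α * (f.sum fun v a => G.degree v * a ^ 2) ≤ _ at h1
    linarith
  have hD0 : 0 ≤ D := Finset.sum_nonneg fun p _ => sq_nonneg _
  have hCS : (2 * α * D) ^ 2 ≤ Q * (4 * D - Q) := by
    calc (2 * α * D) ^ 2 ≤ (∑ p ∈ P, |f p.1 ^ 2 - f p.2 ^ 2|) ^ 2 := by gcongr
      _ ≤ (∑ p ∈ P, |(|f p.1| - |f p.2|)| ^ 2) * ∑ p ∈ P, (|f p.1| + |f p.2|) ^ 2 := by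
        refine le_of_eq_of_le ?_ (Finset.sum_mul_sq_le_sq_mul_sq P _ _)
        congr 1
        refine Finset.sum_congr rfl fun p _ => ?_
        rw [← sq_abs (f p.1), ← sq_abs (f p.2), sq_sub_sq, abs_mul, mul_comm,
          abs_of_nonneg (add_nonneg (abs_nonneg (f p.1)) (abs_nonneg (f p.2)))]
      _ = Q * (4 * D - Q) := by simp only [sq_abs, hQ]; rw [← hQ, ← hQD]
  have := le_of_sq_le_mul_sub hD0 hCS
  rw [← hD', hE]
  linarith

theorem IsIsoperimetric.mul_norm_sq_le (hα : IsIsoperimetric G α) (hα0 : 0 ≤ α) {d : ℝ}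
    (hd : ∀ v, d ≤ G.degree v) (f : V →₀ ℝ) :
    d * (1 - √(1 - α ^ 2)) * ‖coreEmb V f‖ ^ 2
      ≤ inner ℝ (coreLaplacian G f) (coreEmb V f) := by
  have h0 : 0 ≤ 1 - √(1 - α ^ 2) :=
    sub_nonneg.2 (Real.sqrt_le_one.2 (by nlinarith [sq_nonneg α]))
  rw [inner_coreLaplacian, ← real_inner_self_eq_norm_sq, inner_coreEmb, coreEmb_apply]
  refine le_trans ?_ (hα.cheeger hα0 f)
  rw [mul_right_comm]
  refine mul_le_mul_of_nonneg_right ?_ h0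
  rw [Finsupp.sum, Finsupp.sum, Finset.mul_sum]
  exact Finset.sum_le_sum fun v _ => by
    rw [← sq]; exact mul_le_mul_of_nonneg_right (hd v) (sq_nonneg _)

end Cheeger

end

end RapidlyBranching

namespace RapidlyBranching

noncomputable section

variable {V : Type*}

/-! ### Isoperimetric estimates from the growth of the degrees -/

section Isoperimetry

/-- Sorting the values of `deg` on `W` increasingly, the `j`-th one is at least `j / s`
for large `j`. -/
theorem sum_range_max_le_sum_max {deg : V → ℝ} {s N m : ℝ} (hs : 0 < s) (hNm : N ≤ s * m)
    (hdeg : ∀ (W : Finset V) (v : V), v ∈ W → (∀ w ∈ W, deg w ≤ deg v) → N < W.card →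
      (W.card : ℝ) ≤ s * deg v) (W : Finset V) :
    ∑ j ∈ Finset.range W.card, max m ((j + 1 : ℝ) / s) ≤ ∑ v ∈ W, max m (deg v) := by
  classical
  induction W using Finset.induction_on_max_value deg with
  | empty => simp
  | insert v W hv hmax ih =>
    rw [Finset.card_insert_of_notMem hv, Finset.sum_range_succ, Finset.sum_insert hv, add_comm]
    refine add_le_add (max_le (le_max_left _ _) ?_) ih
    have hcard : ((insert v W).card : ℝ) = W.card + 1 := by
      rw [Finset.card_insert_of_notMem hv]; push_cast; ring
    -- Up to `N` elements nothing is known about degrees, but there `j / s ≤ N / s ≤ m`.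
    rcases le_or_gt ((insert v W).card : ℝ) N with h | h
    · refine le_max_of_le_left ?_
      rw [div_le_iff₀' hs, ← hcard]
      exact h.trans hNm
    · refine le_max_of_le_right ?_
      rw [div_le_iff₀' hs, ← hcard]
      exact hdeg _ v (Finset.mem_insert_self _ _)
        (fun w hw => (Finset.mem_insert.1 hw).elim (fun h => h ▸ le_rfl) (hmax w)) h

/-- The left side is `∫₀ⁿ max(m, x/s) dx`; the right side is its Riemann sum at right endpoints, and
the integrand is monotone. -/
theorem le_sum_range_max {s m : ℝ} (hs : 0 < s) (hm : 0 ≤ m) (n : ℕ) (hn : s * m ≤ n) :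
    s * m ^ 2 / 2 + n ^ 2 / (2 * s) ≤ ∑ j ∈ Finset.range n, max m ((j + 1 : ℝ) / s) := by
  induction n with
  | zero =>
    have : m = 0 := le_antisymm (nonpos_of_mul_nonpos_right (by simpa using hn) hs) hm
    simp [this]
  | succ k ih =>
    rw [Finset.sum_range_succ]
    have hlast := le_max_right m ((k + 1 : ℝ) / s)
    rcases le_or_gt (s * m) k with hk | hk
    · have h : (k : ℝ) ^ 2 / (2 * s) + (k + 1 : ℝ) / s
          = ((k + 1 : ℕ) : ℝ) ^ 2 / (2 * s) + 1 / (2 * s) := by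
        push_cast; field_simp; ring
      have : 0 ≤ 1 / (2 * s) := by positivity
      linarith [ih hk]
    · have h1 : m * k ≤ ∑ j ∈ Finset.range k, max m ((j + 1 : ℝ) / s) := by
        have := Finset.card_nsmul_le_sum (Finset.range k) (fun j : ℕ => max m ((j + 1 : ℝ) / s)) m
          fun j _ => le_max_left _ _
        rwa [Finset.card_range, nsmul_eq_mul, mul_comm] at this
      have h2 : m * k + (k + 1 : ℝ) / s - (s * m ^ 2 / 2 + ((k + 1 : ℕ) : ℝ) ^ 2 / (2 * s))
          = (1 - (s * m - k) ^ 2) / (2 * s) := by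
        push_cast; field_simp; ring
      have h3 : 0 ≤ (1 - (s * m - k) ^ 2) / (2 * s) := by
        push_cast at hn
        refine div_nonneg ?_ (by positivity)
        nlinarith
      linarith

theorem mul_le_sum_range_max {s : ℝ} (hs : 0 < s) (hs1 : s < 1) (m : ℕ) :
    (m + 1) * m ≤ 2 * s / (1 + s ^ 2) *
      ∑ j ∈ Finset.range (m + 1), max (m : ℝ) ((j + 1 : ℝ) / s) := by
  have h := le_sum_range_max hs m.cast_nonneg (m + 1) (by
    push_cast; nlinarith [m.cast_nonneg (α := ℝ)])
  refine le_trans ?_ (mul_le_mul_of_nonneg_left h (by positivity))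
  have h1 : 2 * s / (1 + s ^ 2) * (s * (m : ℝ) ^ 2 / 2 + ((m + 1 : ℕ) : ℝ) ^ 2 / (2 * s))
      = (s ^ 2 * m ^ 2 + (m + 1) ^ 2) / (1 + s ^ 2) := by
    push_cast; field_simp
  -- The difference of the two sides is `m (1 - s²) + 1`.
  rw [h1, le_div_iff₀ (by positivity)]
  nlinarith [mul_nonneg m.cast_nonneg (sub_nonneg.2 (show s ^ 2 ≤ 1 by nlinarith)),
    m.cast_nonneg (α := ℝ)]

variable (G : SimpleGraph V) [G.LocallyFinite]

/-- A vertex of `W` has at most `|W| - 1` neighbours in `W`. -/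
theorem sum_degree_sub_min_le_boundaryCard {W : Finset V} {m : ℕ} (hm : W.card = m + 1) :
    ∑ v ∈ W, (max (m : ℝ) (G.degree v) - m) ≤ boundaryCard G W := by
  classical
  rw [boundaryCard, Nat.cast_sum]
  refine Finset.sum_le_sum fun v hv => ?_
  have h1 : (G.neighborFinset v ∩ W).card ≤ m := by
    rw [← Nat.add_sub_cancel m 1, ← hm, ← Finset.card_erase_of_mem hv]
    refine Finset.card_le_card fun w hw => ?_
    rw [Finset.mem_inter, SimpleGraph.mem_neighborFinset] at hw
    exact Finset.mem_erase.2 ⟨hw.1.ne', hw.2⟩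
  have h2 := Finset.card_sdiff_add_card_inter (G.neighborFinset v) W
  rw [SimpleGraph.card_neighborFinset_eq_degree] at h2
  have h3 : ((G.neighborFinset v \ W).card : ℝ) + (G.neighborFinset v ∩ W).card = G.degree v :=
    mod_cast h2
  have h4 : ((G.neighborFinset v ∩ W).card : ℝ) ≤ m := mod_cast h1
  rw [sub_le_iff_le_add]
  exact max_le (le_add_of_nonneg_left (Nat.cast_nonneg _)) (by
    rw [← h3]; simpa [add_comm] using h4)

variable {G}

theorem isoperimetric_of_card_le {s N : ℝ} (hs : 0 < s) (hs1 : s < 1)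
    (hdeg : ∀ (W : Finset V) (v : V), v ∈ W → (∀ w ∈ W, G.degree w ≤ G.degree v) → N < W.card →
      (W.card : ℝ) ≤ s * G.degree v) {W : Finset V} {m : ℕ} (hm : W.card = m + 1)
    (hNm : N ≤ s * m) :
    (1 - s) ^ 2 / (1 + s ^ 2) * ∑ v ∈ W, (G.degree v : ℝ) ≤ boundaryCard G W := by
  have h1 := sum_degree_sub_min_le_boundaryCard G hm
  rw [Finset.sum_sub_distrib, Finset.sum_const, hm, nsmul_eq_mul] at h1
  push_cast at h1
  have h2 := sum_range_max_le_sum_max (deg := fun v => (G.degree v : ℝ)) hs hNm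
    (fun W v hv hmax => hdeg W v hv fun w hw => mod_cast hmax w hw) W
  rw [hm] at h2
  have h3 := (mul_le_sum_range_max hs hs1 m).trans (mul_le_mul_of_nonneg_left h2 (by positivity))
  have h4 : ∑ v ∈ W, (G.degree v : ℝ) ≤ ∑ v ∈ W, max (m : ℝ) (G.degree v) :=
    Finset.sum_le_sum fun v _ => le_max_right _ _
  have h5 : (1 - s) ^ 2 / (1 + s ^ 2) = 1 - 2 * s / (1 + s ^ 2) := by
    field_simp; ring
  have h6 := mul_le_mul_of_nonneg_left h4 (a := (1 - s) ^ 2 / (1 + s ^ 2)) (by positivity)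
  refine h6.trans ?_
  rw [h5]
  linarith

theorem isIsoperimetric_of_card_le {s : ℝ} (hs : 0 < s) (hs1 : s < 1)
    (hdeg : ∀ (W : Finset V) (v : V), v ∈ W → (∀ w ∈ W, G.degree w ≤ G.degree v) →
      (W.card : ℝ) ≤ s * G.degree v) : IsIsoperimetric G ((1 - s) ^ 2 / (1 + s ^ 2)) := by
  intro W
  rcases W.eq_empty_or_nonempty with rfl | hW
  · simp [boundaryCard]
  obtain ⟨m, hm⟩ := Nat.exists_eq_succ_of_ne_zero (Finset.card_ne_zero.2 hW)
  exact isoperimetric_of_card_le (N := 0) hs hs1 (fun W v hv h _ => hdeg W v hv h) hm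
    (by positivity)

/-- A walk from `W` to a vertex outside must cross the boundary. -/
theorem one_le_boundaryCard [Infinite V] (hconn : G.Connected) {W : Finset V}
    (hW : W.Nonempty) : 1 ≤ boundaryCard G W := by
  classical
  obtain ⟨u, hu⟩ := hW
  obtain ⟨v, hv⟩ := Infinite.exists_notMem_finset W
  obtain ⟨p⟩ := hconn.preconnected u v
  obtain ⟨e, -, h1, h2⟩ := p.exists_boundary_dart (W : Set V) hu hv
  have h3 : e.snd ∈ G.neighborFinset e.fst \ W :=
    Finset.mem_sdiff.2 ⟨(G.mem_neighborFinset _ _).2 e.adj, h2⟩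
  exact (Finset.card_pos.2 ⟨_, h3⟩).trans_le
    (Finset.single_le_sum (f := fun v => (G.neighborFinset v \ W).card)
      (fun _ _ => Nat.zero_le _) h1)

theorem one_le_degree [Infinite V] (hconn : G.Connected) (v : V) : 1 ≤ G.degree v := by
  classical
  have h := one_le_boundaryCard hconn (Finset.singleton_nonempty v)
  rw [boundaryCard, Finset.sum_singleton] at h
  exact h.trans ((Finset.card_le_card Finset.sdiff_subset).trans_eq
    (G.card_neighborFinset_eq_degree v))

theorem exists_isIsoperimetric_pos [Infinite V] (hconn : G.Connected) {s : ℝ} (hs : 0 < s)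
    (hs1 : s < 1) (k : ℕ)
    (hcard : ∀ n ≥ k, ∀ W : Finset V, (∀ v ∈ W, G.degree v ≤ n) → (W.card : ℝ) ≤ s * n) :
    ∃ α, 0 < α ∧ IsIsoperimetric G α := by
  refine ⟨min ((1 - s) ^ 2 / (1 + s ^ 2)) (1 / (1 + (k : ℝ) * k)), lt_min ?_ (by positivity),
    fun W => ?_⟩
  · have := sub_pos.2 hs1
    positivity
  have hD : 0 ≤ ∑ v ∈ W, (G.degree v : ℝ) := Finset.sum_nonneg fun _ _ => Nat.cast_nonneg _
  rcases W.eq_empty_or_nonempty with rfl | hW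
  · simp [boundaryCard]
  obtain ⟨m, hm⟩ := Nat.exists_eq_succ_of_ne_zero (Finset.card_ne_zero.2 hW)
  rcases le_or_gt k m with hkm | hkm
  -- With `N = s k`, a set of more than `N` vertices has maximal degree at least `k`, where the
  -- count applies.
  · refine (mul_le_mul_of_nonneg_right (min_le_left _ _) hD).trans
      (isoperimetric_of_card_le (N := s * k) hs hs1 (fun W v _ hmax hN => ?_) hm (by gcongr))
    rcases le_or_gt k (G.degree v) with h | h
    · exact hcard _ h W hmax
    · exact absurd (hcard k le_rfl W fun w hw => (hmax w hw).trans h.le) (not_le.2 hN)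
  -- Here `(m + 1) m ≤ k²`, so `deg W ≤ |∂W| + k² ≤ (1 + k²) |∂W|`.
  · refine (mul_le_mul_of_nonneg_right (min_le_right _ _) hD).trans ?_
    have h1 := sum_degree_sub_min_le_boundaryCard G hm
    have h2 : (1 : ℝ) ≤ boundaryCard G W := mod_cast one_le_boundaryCard hconn hW
    have h3 : ∑ v ∈ W, (G.degree v : ℝ) ≤ ∑ v ∈ W, max (m : ℝ) (G.degree v) :=
      Finset.sum_le_sum fun v _ => le_max_right _ _
    rw [Finset.sum_sub_distrib, Finset.sum_const, hm, nsmul_eq_mul] at h1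
    have h4 : ((m.succ : ℕ) : ℝ) * m ≤ k * k := by
      have h5 : m.succ * m ≤ k * k := Nat.mul_le_mul hkm hkm.le
      exact_mod_cast h5
    rw [div_mul_eq_mul_div, one_mul, div_le_iff₀ (by positivity)]
    nlinarith [mul_nonneg (sub_nonneg.2 h2) (mul_self_nonneg (k : ℝ))]

/-! ### From `r` and `r_∞` to isoperimetric constants and the spectrum -/

theorem card_le_of_etaRatio_le {s : ℝ} (hs : 0 ≤ s) {k : ℕ} (hk : 1 ≤ k)
    (h : etaRatio G k ≤ ENNReal.ofReal s) (W : Finset V) (hW : ∀ v ∈ W, G.degree v ≤ k) :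
    (W.card : ℝ) ≤ s * k := by
  have h1 : ((W.card : ℕ∞) : ℝ≥0∞) ≤ (eta G k : ℕ∞) := by
    refine ENat.toENNReal_mono ?_
    rw [eta, ← Set.encard_coe_eq_coe_finsetCard]
    exact Set.encard_le_encard fun v hv => Set.mem_ofPred.2 (Nat.cast_le.2 (hW v hv))
  have hk0 : (k : ℝ≥0∞) ≠ 0 := by simp; omega
  rw [etaRatio, ENNReal.div_le_iff hk0 (ENNReal.natCast_ne_top k), ← ENNReal.ofReal_natCast k,
    ← ENNReal.ofReal_mul hs] at h
  have h2 := h1.trans h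
  rw [ENat.toENNReal_coe, ← ENNReal.ofReal_natCast, ENNReal.ofReal_le_ofReal_iff (by positivity)]
    at h2
  exact h2

theorem exists_isIsoperimetric_of_rInf_lt_one [Infinite V] (hconn : G.Connected)
    (hr : rInf G < 1) : ∃ α, 0 < α ∧ IsIsoperimetric G α := by
  obtain ⟨s, hs, hs1⟩ := ENNReal.lt_iff_exists_nnreal_btwn.1 hr
  obtain ⟨k, hk⟩ := eventually_atTop.1 (eventually_lt_of_limsup_lt hs)
  have hs0 : 0 < (s : ℝ) := by
    have := pos_of_gt hs
    exact_mod_cast this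
  refine exists_isIsoperimetric_pos hconn hs0 (mod_cast hs1) (max k 1) fun n hn W hW => ?_
  refine card_le_of_etaRatio_le hs0.le ((le_max_right _ _).trans hn) ?_ W hW
  rw [ENNReal.ofReal_coe_nnreal]
  exact (hk n ((le_max_left _ _).trans hn)).le

theorem isIsoperimetric_of_rSup_lt_one [Infinite V] (hconn : G.Connected) (hr : rSup G < 1) :
    (rSup G).toReal < 1 ∧
      IsIsoperimetric G ((1 - (rSup G).toReal) ^ 2 / (1 + (rSup G).toReal ^ 2)) := by
  have htop : rSup G ≠ ⊤ := (hr.trans ENNReal.one_lt_top).ne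
  have hs1 : (rSup G).toReal < 1 := by
    rw [← ENNReal.toReal_one]
    exact (ENNReal.toReal_lt_toReal htop ENNReal.one_ne_top).2 hr
  have hcard (W : Finset V) (v : V) (hmax : ∀ w ∈ W, G.degree w ≤ G.degree v) :
      (W.card : ℝ) ≤ (rSup G).toReal * G.degree v := by
    refine card_le_of_etaRatio_le ENNReal.toReal_nonneg (one_le_degree hconn v) ?_ W hmax
    rw [ENNReal.ofReal_toReal htop]
    exact le_iSup₂ (f := fun (k : ℕ) (_ : 1 ≤ k) => etaRatio G k) _ (one_le_degree hconn v)
  -- A single vertex `v` already gives `1 ≤ r deg v`.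
  have hs0 : 0 < (rSup G).toReal := by
    obtain ⟨v⟩ := hconn.nonempty
    have h := hcard {v} v (by simp)
    rw [Finset.card_singleton, Nat.cast_one] at h
    exact pos_of_mul_pos_left (one_pos.trans_le h) (Nat.cast_nonneg _)
  exact ⟨hs1, isIsoperimetric_of_card_le hs0 hs1 fun W v _ h => hcard W v h⟩

theorem minDeg_le_degree (v : V) : minDeg G ≤ G.degree v := Nat.sInf_le ⟨v, rfl⟩

theorem one_le_minDeg [Infinite V] (hconn : G.Connected) : 1 ≤ minDeg G := by
  obtain ⟨v, hv⟩ := Nat.sInf_mem (Set.range_nonempty fun v : V => G.degree v)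
  exact (one_le_degree hconn v).trans_eq hv

end Isoperimetry

theorem IsIsoperimetric.spectrumSet_laplacian [Nonempty V] {G : SimpleGraph V} [G.LocallyFinite]
    {α : ℝ} (hα : IsIsoperimetric G α) (hα0 : 0 ≤ α) :
    (spectrumSet (laplacian G)).Nonempty ∧
      ∀ μ ∈ spectrumSet (laplacian G), (minDeg G : ℝ) * (1 - √(1 - α ^ 2)) ≤ μ :=
  spectrumSet_laplacian_nonempty_and_le G
    (mul_nonneg (Nat.cast_nonneg _)
      (sub_nonneg.2 (Real.sqrt_le_one.2 (by nlinarith [sq_nonneg α]))))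
    (hα.mul_norm_sq_le hα0 fun v => Nat.cast_le.2 (minDeg_le_degree v))

end

end RapidlyBranching

theorem theorem1 {V : Type*} [Infinite V] (G : SimpleGraph V) [G.LocallyFinite]
    (hconn : G.Connected)
    (hd : RapidlyBranching.dInf G = ⊤) (hr : RapidlyBranching.rInf G < 1) :
    (RapidlyBranching.spectrumSet (RapidlyBranching.laplacian G)).Nonempty ∧
    BddBelow (RapidlyBranching.spectrumSet (RapidlyBranching.laplacian G)) ∧
    0 < RapidlyBranching.bottom G ∧
    (RapidlyBranching.rSup G < 1 →
      (RapidlyBranching.minDeg G : ℝ) *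
          (1 - RapidlyBranching.gammaFn (RapidlyBranching.rSup G).toReal) ≤
        RapidlyBranching.bottom G) := by
  obtain ⟨α, hα0, hα⟩ := RapidlyBranching.exists_isIsoperimetric_of_rInf_lt_one hconn hr
  obtain ⟨hne, hle⟩ := hα.spectrumSet_laplacian hα0.le
  refine ⟨hne, ⟨_, hle⟩, lt_of_lt_of_le ?_ (le_csInf hne hle), fun hr1 => ?_⟩
  · refine mul_pos (Nat.cast_pos.2 (RapidlyBranching.one_le_minDeg hconn)) (sub_pos.2 ?_)
    rw [Real.sqrt_lt' one_pos]
    nlinarith [pow_pos hα0 2]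
  · obtain ⟨hs1, hs⟩ := RapidlyBranching.isIsoperimetric_of_rSup_lt_one hconn hr1
    obtain ⟨-, hle'⟩ := hs.spectrumSet_laplacian (by positivity)
    refine le_csInf hne fun μ hμ => (le_of_eq ?_).trans (hle' μ hμ)
    rw [RapidlyBranching.gammaFn, div_pow, ← pow_mul]
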